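/- Let $\Lambda=\{\lambda_1,\dots,\lambda_n\}$ be a set of $n$ distinct real numbers which is strongly disjoint: any two disjoint nonempty subsets of $\Lambda$ have different averages. Let $\mathrm{Sym}(\Lambda)$ be the manifold of real symmetric $n\times n$ matrices with set of eigenvalues $\Lambda$, with tangent spaces $T_H\mathrm{Sym}(\Lambda)=\{[H,\Omega]:\Omega^T=-\Omega\}$ and the normal metric $g([H,\Omega_1],[H,\Omega_2])=-\mathrm{tr}(\Omega_1\Omega_2)$, and let $\Psi(H)=\frac12\sum_{i=1}^n d_i^2$ be the diagonal potential, where $d_1,\dots,d_n$ are the diagonal entries of $H$. For an ordered partition $\alpha=(\Lambda_1,\dots,\Lambda_k)$ of $\Lambda$ into nonempty subsets, let $E_\alpha$ be the set of block-diagonal matrices $\mathrm{Diag}(H_1,\dots,H_k)$ such that, for each $p$, $H_p\in\mathrm{Sym}(\Lambda_p)$ and all diagonal entries of $H_p$ are equal to the average of $\Lambda_p$. A critical manifold of $\Psi$ is a set of the form $P^TE_\alpha P$ with $\alpha$ an ordered partition of $\Lambda$ and $P$ a permutation matrix. The co-index of a critical manifold $E$ at $H\in E$ is the number of positive eigenvalues,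 counted with multiplicity, of the Hessian of $\Psi$ at $H$ restricted to the normal space $N_HE$ of $E$ in $T_H\mathrm{Sym}(\Lambda)$ (both taken with respect to $g$). For every critical manifold $E$ the following are equivalent: (i) $E$ is stable, that is, its co-index is $0$ at some point of $E$; (ii) the co-index of $E$ is $0$ at every point of $E$; (iii) $E$ is a singleton consisting of a diagonal matrix. -/

import Mathlib

open scoped Matrix ContDiff

noncomputable section

namespace DiagonalPotential

/-- The average `μ(A)` of a finite set of real numbers. -/
def mean (A : Finset ℝ) : ℝ := (∑ x ∈ A, x) / (A.card : ℝ)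

/-- Nonempty disjoint subsets of `Λ` have different averages. -/
def StronglyDisjoint (Λ : Finset ℝ) : Prop :=
  ∀ A B : Finset ℝ, A ⊆ Λ → B ⊆ Λ → A.Nonempty → B.Nonempty → Disjoint A B → mean A ≠ mean B

/-- Real square matrices of size `n = #Λ`. -/
abbrev Mat (Λ : Finset ℝ) : Type := Matrix (Fin Λ.card) (Fin Λ.card) ℝ

/-- The isospectral manifold `Sym(Λ)`: symmetric matrices of size `#Λ` whose eigenvalues,
counted with multiplicity, are the elements of `Λ`. -/
def isospectral (Λ : Finset ℝ) : Set (Mat Λ) :=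
  {H | H.IsSymm ∧ H.charpoly = ∏ x ∈ Λ, (Polynomial.X - Polynomial.C x)}

/-! ### Riemannian structure -/

/-- `T_H Sym(Λ)`, the set of all `[H, Ω]` with `Ω` skew symmetric. -/
def tangentSpace {Λ : Finset ℝ} (H : Mat Λ) : Set (Mat Λ) :=
  {X | ∃ Ω : Mat Λ, Ωᵀ = -Ω ∧ ⁅H, Ω⁆ = X}

open Classical in
/-- The inverse of `ad_H : Ω ↦ [H, Ω]` on tangent vectors: the skew symmetric `Ω` with
`[H, Ω] = X`, which is unique when the eigenvalues of the symmetric matrix `H` are distinct.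
(It is `0` if `X` is not tangent.) -/
def adInv {Λ : Finset ℝ} (H X : Mat Λ) : Mat Λ :=
  if h : ∃ Ω : Mat Λ, Ωᵀ = -Ω ∧ ⁅H, Ω⁆ = X then h.choose else 0

/-- The normal metric, `g([H, Ω₁], [H, Ω₂]) = -tr(Ω₁ Ω₂)`. -/
def normalMetric {Λ : Finset ℝ} (H X Y : Mat Λ) : ℝ :=
  -(adInv H X * adInv H Y).trace

/-- The diagonal potential `Ψ(H) = (1/2) ∑ d_i²`, `d_i` the diagonal entries of `H`. -/
def potential {Λ : Finset ℝ} (H : Mat Λ) : ℝ := (1 / 2) * ∑ i, H i i ^ 2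

/-- The Hessian of the diagonal potential at an equilibrium `H`, on tangent vectors `X, Y`:
`X (Ỹ Ψ) = X (g(grad Ψ, Ỹ))`, where `Ỹ` is the tangent vector field `K ↦ [K, Ω]` on `Sym(Λ)`
that extends `Y = [H, Ω]`. -/
def hessian {Λ : Finset ℝ} (H X Y : Mat Λ) : ℝ :=
  lineDeriv ℝ (fun K : Mat Λ => lineDeriv ℝ potential K ⁅K, adInv H Y⁆) H X

/-- Tangent vectors at `H` to a submanifold `E`: velocities at time `0` of smooth curves in `E`
through `H`. -/
def tangentVectors {Λ : Finset ℝ} (E : Set (Mat Λ)) (H : Mat Λ) : Set (Mat Λ) :=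
  {X | ∃ γ : ℝ → Mat Λ, (∀ i j, ContDiff ℝ ∞ (fun t => γ t i j)) ∧ (∀ t, γ t ∈ E) ∧ γ 0 = H ∧
    ∀ i j, X i j = deriv (fun t => γ t i j) 0}

/-- The normal space `N_H E` in `T_H Sym(Λ)` with respect to the normal metric. -/
def normalSpace {Λ : Finset ℝ} (E : Set (Mat Λ)) (H : Mat Λ) : Set (Mat Λ) :=
  {X | X ∈ tangentSpace H ∧ ∀ Y ∈ tangentVectors E H, normalMetric H X Y = 0}

/-- Eigenvectors of the Hessian restricted to `N_H E` for the eigenvalue `c` (and zero): those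
`X` in `N_H E` whose image `L X` under the operator `L` on `N_H E` given by
`g(L X, Y) = Hess(X, Y)` is `c X`. -/
def eigenvectors {Λ : Finset ℝ} (E : Set (Mat Λ)) (H : Mat Λ) (c : ℝ) : Set (Mat Λ) :=
  {X | X ∈ normalSpace E H ∧ ∀ Y ∈ normalSpace E H, hessian H X Y = c * normalMetric H X Y}

/-- The co-index of `E` computed at `H ∈ E`: the number of positive eigenvalues, with
multiplicity, of the Hessian restricted to `N_H E`, that is, the dimension of the sum of the
eigenspaces of positive eigenvalues. -/
def coindexAt {Λ : Finset ℝ} (E : Set (Mat Λ)) (H : Mat Λ) : ℕ :=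
  Module.finrank ℝ (Submodule.span ℝ (⋃ c ∈ Set.Ioi (0 : ℝ), eigenvectors E H c))

/-! ### Critical manifolds -/

/-- An ordered partition `(Λ_1, …, Λ_k)` of `Λ` into nonempty parts. -/
structure OrderedPartition (Λ : Finset ℝ) where
  k : ℕ
  part : Fin k → Finset ℝ
  nonempty : ∀ p, (part p).Nonempty
  disjoint : ∀ p q, p ≠ q → Disjoint (part p) (part q)
  union : Finset.univ.biUnion part = Λ

theorem OrderedPartition.sum_card {Λ : Finset ℝ} (α : OrderedPartition Λ) :
    ∑ p, (α.part p).card = Λ.card := by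
  rw [← Finset.card_biUnion (fun p _ q _ h => α.disjoint p q h), α.union]

/-- The consecutive numbering of the rows of a block matrix with blocks of sizes `#Λ_1, …, #Λ_k`. -/
def OrderedPartition.index {Λ : Finset ℝ} (α : OrderedPartition Λ) :
    ((p : Fin α.k) × Fin (α.part p).card) ≃ Fin Λ.card :=
  finSigmaFinEquiv.trans (finCongr α.sum_card)

/-- `E_α`: the matrices `Diag(H_1, …, H_k)` with `H_p ∈ Sym(Λ_p)` and all diagonal entries of `H_p`
equal to `μ(Λ_p)`. -/
def blockEquilibria {Λ : Finset ℝ} (α : OrderedPartition Λ) : Set (Mat Λ) :=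
  {H | ∃ B : (p : Fin α.k) → Mat (α.part p),
    (∀ p, B p ∈ isospectral (α.part p)) ∧ (∀ p i, B p i i = mean (α.part p)) ∧
    H = Matrix.reindex α.index α.index (Matrix.blockDiagonal' B)}

/-- A critical manifold of the diagonal potential: a set `Pᵀ E_α P` with `P` a permutation matrix. -/
def IsCriticalManifold {Λ : Finset ℝ} (E : Set (Mat Λ)) : Prop :=
  ∃ (α : OrderedPartition Λ) (σ : Equiv.Perm (Fin Λ.card)),
    E = (fun H => (σ.permMatrix ℝ)ᵀ * H * σ.permMatrix ℝ) '' blockEquilibria α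

end DiagonalPotential

end

/-!
A tangent vector `[H, A]` is handled through its skew generator `A`, which is unique because the
spectrum is simple. In terms of generators the metric is `-tr(A B)`, and at an equilibrium, where
`H` commutes with its diagonal part, the Hessian becomes a symmetric bilinear form.

If an equilibrium has `H i j ≠ 0` for some `i ≠ j`, then `d_i = d_j`, and the infinitesimal rotation
in the `(i, j)`-plane has positive second variation. So the Hessian has an eigenvector of positive
eigenvalue on all of `T_H Sym(Λ)`, and it is automatically normal to `E`: the matrices in `E` share
one diagonal and commute with it, so tangent vectors of `E` have zero diagonal and commute with it
as well, which places them in the kernel of the Hessian. Hence stability at one point forces that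
point to be diagonal. Its diagonal entries are then distinct, and a matrix that commutes with it is
diagonal, so `E` is a singleton. Conversely, at a diagonal `H` the second variation along `[H, A]`
is `-‖[H, A]‖² ≤ 0`.

Critical manifolds are nonempty because a symmetric matrix can be rotated, one coordinate plane at a
time, until all its diagonal entries equal their average.
-/

noncomputable section

namespace DiagonalPotential

open Matrix

attribute [local instance] LieRing.ofAssociativeRing

section Commutator

variable {n R : Type*} [Fintype n] [CommRing R]

theorem isSymm_lie {H A : Matrix n n R} (hH : H.IsSymm) (hA : Aᵀ = -A) : ⁅H, A⁆.IsSymm := by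
  simp only [IsSymm, Ring.lie_def, transpose_sub, transpose_mul, hH.eq, hA, Matrix.neg_mul,
    Matrix.mul_neg]
  abel

variable [DecidableEq n]

theorem diagonal_lie_apply (d : n → R) (X : Matrix n n R) (i j : n) :
    ⁅diagonal d, X⁆ i j = (d i - d j) * X i j := by
  rw [Ring.lie_def, Matrix.sub_apply, diagonal_mul, mul_diagonal]
  ring

theorem diagonal_lie_eq_zero_iff [NoZeroDivisors R] {d : n → R} {X : Matrix n n R} :
    ⁅diagonal d, X⁆ = 0 ↔ ∀ i j, d i ≠ d j → X i j = 0 := by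
  simp only [← Matrix.ext_iff, diagonal_lie_apply, Matrix.zero_apply, mul_eq_zero, sub_eq_zero,
    or_iff_not_imp_left, ne_eq]

theorem dotProduct_diag_lie (d : n → R) (X Y : Matrix n n R) :
    d ⬝ᵥ ⁅X, Y⁆.diag = (⁅diagonal d, X⁆ * Y).trace := by
  calc d ⬝ᵥ ⁅X, Y⁆.diag = (diagonal d * ⁅X, Y⁆).trace := by
        simp [dotProduct, trace, diagonal_mul]
    _ = (⁅diagonal d, X⁆ * Y).trace := by
        simp only [Ring.lie_def, Matrix.mul_sub, Matrix.sub_mul, trace_sub]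
        rw [trace_mul_cycle' (diagonal d) Y X, Matrix.mul_assoc, Matrix.mul_assoc]

end Commutator

section SimpleSpectrum

variable {n : Type*} [Fintype n] [DecidableEq n]

theorem isSymm_of_lie_eq_zero {M K : Matrix n n ℝ} (hM : M.IsSymm) (hsep : M.charpoly.Separable)
    (hK : ⁅M, K⁆ = 0) : K.IsSymm := by
  have hH : M.IsHermitian := isHermitian_iff_isSymm.2 hM
  have hinj : Function.Injective hH.eigenvalues := by
    have hroots := Polynomial.nodup_roots hsep
    rw [hH.roots_charpoly_eq_eigenvalues] at hroots
    intro i j hij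
    exact Multiset.inj_on_of_nodup_map hroots i (Finset.mem_univ_val i) j (Finset.mem_univ_val j)
      (by simp [hij])
  let φ := Unitary.conjStarAlgAut ℝ (Matrix n n ℝ) hH.eigenvectorUnitary
  have hφ : φ (diagonal hH.eigenvalues) = M := hH.spectral_theorem.symm
  have hcomm : ⁅diagonal hH.eigenvalues, φ.symm K⁆ = 0 := by
    refine (map_eq_zero_iff φ φ.injective).1 ?_
    rw [Ring.lie_def, map_sub, map_mul, map_mul, hφ, φ.apply_symm_apply, ← Ring.lie_def, hK]
  have hdiag : (φ.symm K).IsDiag := fun i j hij =>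
    diagonal_lie_eq_zero_iff.1 hcomm i j (hinj.ne hij)
  have hstar : star (φ.symm K) = φ.symm K := isHermitian_iff_isSymm.2 hdiag.isSymm
  refine isHermitian_iff_isSymm.1 (?_ : star K = K)
  rw [← φ.apply_symm_apply K, ← map_star, hstar]

theorem eq_zero_of_transpose_eq_neg_of_lie_eq_zero {M A : Matrix n n ℝ} (hM : M.IsSymm)
    (hsep : M.charpoly.Separable) (hA : Aᵀ = -A) (hMA : ⁅M, A⁆ = 0) : A = 0 := by
  have hself : A = -A := (isSymm_of_lie_eq_zero hM hsep hMA).symm.trans hA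
  ext i j
  exact self_eq_neg.1 (congrFun₂ hself i j)

end SimpleSpectrum

section BlockDiagonal

variable {o R : Type*} [Fintype o] [DecidableEq o] [CommRing R]
  {m : o → Type*} [∀ p, Fintype (m p)] [∀ p, DecidableEq (m p)]

theorem det_blockDiagonal' (B : ∀ p, Matrix (m p) (m p) R) :
    (blockDiagonal' B).det = ∏ p, (B p).det := by
  let e := Fintype.equivFin o
  have htri : (blockDiagonal' B).BlockTriangular fun x => e x.1 := fun x y hxy =>
    blockDiagonal'_apply_ne _ _ _ fun h => hxy.ne (congrArg e h.symm)
  rw [htri.det_fintype, ← e.prod_comp]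
  refine Finset.prod_congr rfl fun p _ => ?_
  let block : {x : (q : o) × m q // e x.1 = e p} ≃ m p :=
    (Equiv.subtypeEquivRight fun x => e.apply_eq_iff_eq).trans (Equiv.sigmaSubtype p)
  rw [← det_submatrix_equiv_self block]
  congr 1
  ext ⟨⟨q, i⟩, hq⟩ ⟨⟨r, j⟩, hr⟩
  obtain rfl := e.injective hq
  obtain rfl := e.injective hr
  exact blockDiagonal'_apply_eq _ _ _ _

theorem charpoly_blockDiagonal' (B : ∀ p, Matrix (m p) (m p) R) :
    (blockDiagonal' B).charpoly = ∏ p, (B p).charpoly := by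
  have hchar : (blockDiagonal' B).charmatrix = blockDiagonal' fun p => (B p).charmatrix := by
    ext ⟨p, i⟩ ⟨q, j⟩
    obtain rfl | hpq := eq_or_ne p q
    · simp [charmatrix_apply, diagonal_apply]
    · simp [blockDiagonal'_apply_ne _ _ _ hpq, hpq]
  rw [charpoly, hchar, det_blockDiagonal']
  rfl

end BlockDiagonal

section PositiveEigenvector

theorem exists_pos_hasEigenvalue {V : Type*} [NormedAddCommGroup V] [InnerProductSpace ℝ V]
    [FiniteDimensional ℝ V] {T : V →ₗ[ℝ] V} (hT : T.IsSymmetric) {v : V}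
    (hv : 0 < inner ℝ (T v) v) : ∃ c > 0, Module.End.HasEigenvalue T c := by
  by_contra! hneg
  let b := hT.eigenvectorBasis rfl
  have hsum : inner ℝ (T v) v = ∑ i, hT.eigenvalues rfl i * inner ℝ (b i) v ^ 2 := by
    rw [← b.sum_inner_mul_inner (T v) v]
    refine Finset.sum_congr rfl fun i _ => ?_
    rw [hT v (b i), hT.apply_eigenvectorBasis, RCLike.ofReal_real_eq_id, id, inner_smul_right,
      real_inner_comm]
    ring
  have hnonpos : ∀ i, hT.eigenvalues rfl i ≤ 0 := fun i =>
    not_lt.1 fun hi => hneg _ hi (hT.hasEigenvalue_eigenvalues rfl i)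
  refine hv.not_ge (hsum.trans_le (Finset.sum_nonpos fun i _ => ?_))
  exact mul_nonpos_of_nonpos_of_nonneg (hnonpos i) (sq_nonneg _)

theorem exists_pos_eigenvector {V : Type*} [AddCommGroup V] [Module ℝ V] [FiniteDimensional ℝ V]
    {g h : LinearMap.BilinForm ℝ V} (hg : g.IsSymm) (gpos : ∀ x ≠ 0, 0 < g x x) (hh : h.IsSymm)
    {v : V} (hv : 0 < h v v) : ∃ c > 0, ∃ x ≠ 0, ∀ y, h x y = c * g x y := by
  let core : InnerProductSpace.Core ℝ V :=
    { inner := fun x y => g x y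
      conj_inner_symm := fun x y => hg.eq y x
      re_inner_nonneg := fun x => by
        obtain rfl | hx := eq_or_ne x 0
        · simp
        · exact (gpos x hx).le
      add_left := fun x y z => by simp
      smul_left := fun x y r => by simp
      definite := fun x hx => by_contra fun hne => (gpos x hne).ne' hx }
  let _ : NormedAddCommGroup V := core.toNormedAddCommGroup
  let _ : InnerProductSpace ℝ V := InnerProductSpace.ofCore core.toCore
  have : CompleteSpace V := FiniteDimensional.complete ℝ V
  let T : V →ₗ[ℝ] V := (InnerProductSpace.toDual ℝ V).symm.toLinearEquiv.toLinearMap ∘ₗ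
      (LinearMap.toContinuousLinearMap.toLinearMap ∘ₗ h)
  have hT : ∀ x y, g (T x) y = h x y := fun x y =>
    InnerProductSpace.toDual_symm_apply (x := y) (y := LinearMap.toContinuousLinearMap (h x))
  have hsymm : T.IsSymmetric := fun x y =>
    (hT x y).trans ((hh.eq y x).symm.trans ((hT y x).symm.trans (hg.eq x (T y)).symm))
  obtain ⟨c, hc, hTc⟩ := exists_pos_hasEigenvalue hsymm (v := v) (hv.trans_eq (hT v v).symm)
  obtain ⟨x, hx⟩ := hTc.exists_hasEigenvector
  refine ⟨c, hc, x, hx.2, fun y => ?_⟩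
  rw [← hT, hx.apply_eq_smul]
  simp

end PositiveEigenvector

section Rotation

variable {n R : Type*} [Fintype n] [DecidableEq n] [CommRing R]

/-- The rotation with cosine `c` and sine `s` in the plane of two distinct coordinates `i` and `j`,
given by its rows. -/
def planeRotation (i j : n) (c s : R) : Matrix n n R :=
  of fun k => if k = i then c • Pi.single i 1 + s • Pi.single j 1
    else if k = j then -s • Pi.single i 1 + c • Pi.single j 1 else Pi.single k 1

theorem planeRotation_mul_apply (i j : n) (c s : R) (A : Matrix n n R) (k l : n) :
    (planeRotation i j c s * A) k l = if k = i then c * A i l + s * A j l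
      else if k = j then -s * A i l + c * A j l else A k l := by
  simp only [mul_apply, planeRotation, of_apply]
  split_ifs <;> simp [add_mul, Finset.sum_add_distrib, Pi.single_apply]

theorem planeRotation_mem_orthogonalGroup {i j : n} (hij : i ≠ j) {c s : R}
    (h : c ^ 2 + s ^ 2 = 1) : planeRotation i j c s ∈ orthogonalGroup n R := by
  refine (mem_orthogonalGroup_iff n R).2 (?_ : _ * (planeRotation i j c s)ᵀ = 1)
  ext k l
  rw [planeRotation_mul_apply]
  simp only [transpose_apply, planeRotation, of_apply, one_apply]
  split_ifs <;> grind [Pi.add_apply, Pi.smul_apply, smul_eq_mul]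

theorem mul_planeRotation_transpose_apply (i j : n) (c s : R) (A : Matrix n n R) (k l : n) :
    (A * (planeRotation i j c s)ᵀ) k l = if l = i then c * A k i + s * A k j
      else if l = j then -s * A k i + c * A k j else A k l := by
  rw [← transpose_apply (A * _), transpose_mul, transpose_transpose, planeRotation_mul_apply]
  rfl

theorem exists_orthogonal_conj_diag_eq {M : Matrix n n ℝ} {i j : n} {m : ℝ} (hi : M i i < m)
    (hj : m < M j j) : ∃ U ∈ orthogonalGroup n ℝ, (U * M * Uᵀ) i i = m ∧
      ∀ k, k ≠ i → k ≠ j → (U * M * Uᵀ) k k = M k k := by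
  have hij : i ≠ j := by
    rintro rfl
    exact hi.not_gt hj
  let f : ℝ → ℝ := fun θ => Real.cos θ * (Real.cos θ * M i i + Real.sin θ * M j i) +
    Real.sin θ * (Real.cos θ * M i j + Real.sin θ * M j j)
  have hf : Continuous f := by fun_prop
  obtain ⟨θ, hθ⟩ : m ∈ Set.range f :=
    mem_range_of_exists_le_of_exists_ge hf ⟨0, by simp [f, hi.le]⟩ ⟨Real.pi / 2, by simp [f, hj.le]⟩
  refine ⟨planeRotation i j (Real.cos θ) (Real.sin θ),
    planeRotation_mem_orthogonalGroup hij (Real.cos_sq_add_sin_sq θ), ?_, fun k hki hkj => ?_⟩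
  · simpa only [mul_planeRotation_transpose_apply, planeRotation_mul_apply, if_true] using hθ
  · simp only [mul_planeRotation_transpose_apply, planeRotation_mul_apply, if_neg hki, if_neg hkj]

theorem trace_orthogonal_conj {U : Matrix n n R} (hU : U ∈ orthogonalGroup n R)
    (M : Matrix n n R) : (U * M * Uᵀ).trace = M.trace := by
  have hUU : Uᵀ * U = 1 := (mem_orthogonalGroup_iff' n R).1 hU
  rw [trace_mul_comm, ← Matrix.mul_assoc, hUU, Matrix.one_mul]

theorem charpoly_orthogonal_conj {U : Matrix n n R} (hU : U ∈ orthogonalGroup n R)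
    (M : Matrix n n R) : (U * M * Uᵀ).charpoly = M.charpoly := by
  have hUU : Uᵀ * U = 1 := (mem_orthogonalGroup_iff' n R).1 hU
  rw [charpoly_mul_comm, ← Matrix.mul_assoc, hUU, Matrix.one_mul]

theorem exists_orthogonal_conj_card_diag_ne_lt {M : Matrix n n ℝ} {m : ℝ}
    (hm : M.trace = Fintype.card n * m) {l : n} (hl : M l l ≠ m) :
    ∃ U ∈ orthogonalGroup n ℝ, Fintype.card {k // (U * M * Uᵀ) k k ≠ m} <
      Fintype.card {k // M k k ≠ m} := by
  have hsum : ∑ i, (M i i - m) = 0 := by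
    rw [Finset.sum_sub_distrib]
    simpa [sub_eq_zero, trace] using hm
  have hsum' : ∑ i, (m - M i i) = 0 := by
    simpa using congrArg Neg.neg hsum
  obtain ⟨j, -, hj⟩ := Finset.exists_pos_of_sum_zero_of_exists_nonzero _ hsum
    ⟨l, Finset.mem_univ l, sub_ne_zero.2 hl⟩
  obtain ⟨i, -, hi⟩ := Finset.exists_pos_of_sum_zero_of_exists_nonzero _ hsum'
    ⟨l, Finset.mem_univ l, sub_ne_zero.2 hl.symm⟩
  rw [sub_pos] at hi hj
  obtain ⟨U, hU, hUi, hUk⟩ := exists_orthogonal_conj_diag_eq hi hj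
  have hsub : ∀ k, (U * M * Uᵀ) k k ≠ m → M k k ≠ m := by
    intro k hk
    obtain rfl | hkj := eq_or_ne k j
    · exact hj.ne'
    · rwa [← hUk k (fun hki => hk (hki ▸ hUi)) hkj]
  refine ⟨U, hU, Fintype.card_lt_of_injective_of_notMem (Subtype.impEmbedding _ _ hsub)
    (Subtype.impEmbedding _ _ hsub).injective (b := ⟨i, hi.ne⟩) ?_⟩
  rintro ⟨⟨k, hk⟩, hki⟩
  obtain rfl : k = i := congrArg Subtype.val hki
  exact hk hUi

theorem exists_orthogonal_conj_diag_eq_const {M : Matrix n n ℝ} {m : ℝ}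
    (hm : M.trace = Fintype.card n * m) :
    ∃ U ∈ orthogonalGroup n ℝ, ∀ i, (U * M * Uᵀ) i i = m := by
  induction hk : Fintype.card {k // M k k ≠ m} using Nat.strong_induction_on
    generalizing M with
  | _ k ih =>
  by_cases! hdiag : ∀ i, M i i = m
  · exact ⟨1, one_mem _, by simpa using hdiag⟩
  obtain ⟨l, hl⟩ := hdiag
  obtain ⟨U, hU, hlt⟩ := exists_orthogonal_conj_card_diag_ne_lt hm hl
  obtain ⟨V, hV, hVM⟩ := ih _ (hk ▸ hlt) ((trace_orthogonal_conj hU M).trans hm) rfl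
  refine ⟨V * U, mul_mem hV hU, fun i => ?_⟩
  rw [← hVM i, transpose_mul]
  simp only [Matrix.mul_assoc]

end Rotation

section TraceForm

variable {n R : Type*} [Fintype n] [CommRing R]

variable (n R) in
/-- The form `-tr(A B)`, positive definite on real skew-symmetric matrices. -/
def negTraceForm : LinearMap.BilinForm R (Matrix n n R) :=
  -(LinearMap.mul R (Matrix n n R)).compr₂ (traceLinearMap n R R)

theorem negTraceForm_apply (A B : Matrix n n R) : negTraceForm n R A B = -(A * B).trace := by
  simp [negTraceForm]

variable (n R) in
theorem negTraceForm_isSymm : (negTraceForm n R).IsSymm :=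
  ⟨fun A B => by simp only [negTraceForm_apply, trace_mul_comm A B]⟩

theorem negTraceForm_self_pos {A : Matrix n n ℝ} (hA : Aᵀ = -A) (hA0 : A ≠ 0) :
    0 < negTraceForm n ℝ A A := by
  have heq : negTraceForm n ℝ A A = (Aᴴ * A).trace := by
    simp [negTraceForm_apply, hA]
  rw [heq]
  exact (posSemidef_conjTranspose_mul_self A).trace_nonneg.lt_of_ne'
    (trace_conjTranspose_mul_self_eq_zero_iff.not.2 hA0)

end TraceForm

section HessianForm

variable {n R : Type*} [Fintype n] [DecidableEq n] [CommRing R]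

/-- The second derivative of the diagonal potential at `H` in the direction `[H, A]` and along the
vector field `K ↦ [K, B]`, as a bilinear form in the generators `A` and `B`. -/
def hessianForm (H : Matrix n n R) : LinearMap.BilinForm R (Matrix n n R) :=
  LinearMap.mk₂ R (fun A B => ⁅H, A⁆.diag ⬝ᵥ ⁅H, B⁆.diag + H.diag ⬝ᵥ ⁅⁅H, A⁆, B⁆.diag)
    (fun A A' B => by simp only [lie_add, add_lie, diag_add, add_dotProduct, dotProduct_add]; abel)
    (fun c A B => by
      simp only [lie_smul, smul_lie, diag_smul, smul_dotProduct, dotProduct_smul, smul_add])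
    (fun A B B' => by simp only [lie_add, diag_add, dotProduct_add]; abel)
    (fun c A B => by simp only [lie_smul, diag_smul, dotProduct_smul, smul_add])

theorem hessianForm_apply (H A B : Matrix n n R) : hessianForm H A B =
    ⁅H, A⁆.diag ⬝ᵥ ⁅H, B⁆.diag + H.diag ⬝ᵥ ⁅⁅H, A⁆, B⁆.diag :=
  rfl

theorem hessianForm_isSymm {H : Matrix n n R} (hH : ⁅diagonal H.diag, H⁆ = 0) :
    (hessianForm H).IsSymm := by
  refine ⟨fun A B => ?_⟩
  have hjacobi : ⁅⁅H, A⁆, B⁆ = ⁅⁅H, B⁆, A⁆ + ⁅H, ⁅A, B⁆⁆ := by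
    rw [leibniz_lie H A B, ← lie_skew A ⁅H, B⁆]
    abel
  have hzero : H.diag ⬝ᵥ ⁅H, ⁅A, B⁆⁆.diag = 0 := by
    rw [dotProduct_diag_lie, hH, Matrix.zero_mul, trace_zero]
  simp only [hessianForm_apply]
  rw [hjacobi, diag_add, dotProduct_add, hzero, add_zero, dotProduct_comm ⁅H, A⁆.diag]

theorem hessianForm_eq_zero_of_diag_eq_zero {H A : Matrix n n R} (hdiag : ⁅H, A⁆.diag = 0)
    (hcomm : ⁅diagonal H.diag, ⁅H, A⁆⁆ = 0) (B : Matrix n n R) : hessianForm H A B = 0 := by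
  rw [hessianForm_apply, hdiag, dotProduct_diag_lie H.diag, hcomm, zero_dotProduct, Matrix.zero_mul,
    trace_zero, add_zero]

theorem hessianForm_self (H A : Matrix n n R) : hessianForm H A A =
    ⁅H, A⁆.diag ⬝ᵥ ⁅H, A⁆.diag - (⁅diagonal H.diag, A⁆ * ⁅H, A⁆).trace := by
  rw [hessianForm_apply, ← lie_skew ⁅H, A⁆ A, diag_neg, dotProduct_neg, dotProduct_diag_lie H.diag,
    sub_eq_add_neg]

theorem hessianForm_self_nonpos_of_isDiag {H A : Matrix n n ℝ} (hH : H.IsDiag) (hA : Aᵀ = -A) :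
    hessianForm H A A ≤ 0 := by
  have hsymm : ⁅H, A⁆ᴴ = ⁅H, A⁆ :=
    isHermitian_iff_isSymm.2 (isSymm_lie hH.isSymm hA)
  have hdiag : ⁅H, A⁆.diag = 0 := by
    rw [← hH.diagonal_diag]
    ext i
    rw [diag_apply, diagonal_lie_apply, sub_self, zero_mul, Pi.zero_apply]
  have htrace : 0 ≤ (⁅H, A⁆ᴴ * ⁅H, A⁆).trace :=
    (posSemidef_conjTranspose_mul_self ⁅H, A⁆).trace_nonneg
  rw [hessianForm_self, hH.diagonal_diag, hdiag, zero_dotProduct, zero_sub, neg_nonpos]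
  rwa [hsymm] at htrace

theorem exists_hessianForm_self_pos {H : Matrix n n ℝ} (hH : H.IsSymm) {i j : n} (hij : i ≠ j)
    (hne : H i j ≠ 0) (hdiag : H i i = H j j) : ∃ A, Aᵀ = -A ∧ 0 < hessianForm H A A := by
  let A : Matrix n n ℝ := single i j 1 - single j i 1
  have hcomm : ⁅diagonal H.diag, A⁆ = 0 := by
    refine diagonal_lie_eq_zero_iff.2 fun k l hkl => ?_
    change single i j 1 k l - single j i 1 k l = (0 : ℝ)
    rw [single_apply_of_ne, single_apply_of_ne, sub_zero]
    · rintro ⟨rfl, rfl⟩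
      exact hkl hdiag.symm
    · rintro ⟨rfl, rfl⟩
      exact hkl hdiag
  have hii : ⁅H, A⁆ i i = -2 * H i j := by
    have hHA : (H * A) i i = -H i j := by simp [A, Matrix.mul_sub, hij]
    have hAH : (A * H) i i = H i j := by simp [A, Matrix.sub_mul, hij, hH.apply i j]
    rw [Ring.lie_def, Matrix.sub_apply, hHA, hAH]
    ring
  refine ⟨A, by simp [A], ?_⟩
  rw [hessianForm_self, hcomm, Matrix.zero_mul, trace_zero, sub_zero]
  have hdiag_ne : ⁅H, A⁆.diag ≠ 0 := fun hzero => by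
    simpa [hii, hne] using congrFun hzero i
  simpa only [star_trivial] using dotProduct_star_self_pos_iff.2 hdiag_ne

end HessianForm

theorem exists_skew_eigenvector_hessianForm {n : Type*} [Fintype n] [DecidableEq n]
    {H : Matrix n n ℝ} (hH : H.IsSymm) (hcomm : ⁅diagonal H.diag, H⁆ = 0) (hdiag : ¬H.IsDiag) :
    ∃ c > 0, ∃ A, Aᵀ = -A ∧ A ≠ 0 ∧
      ∀ B, Bᵀ = -B → hessianForm H A B = c * negTraceForm n ℝ A B := by
  let W := (LieAlgebra.Orthogonal.so n ℝ).toSubmodule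
  have mem_W : ∀ A, A ∈ W ↔ Aᵀ = -A := LieAlgebra.Orthogonal.mem_so n ℝ
  obtain ⟨i, j, hij, hne⟩ : ∃ i j, i ≠ j ∧ H i j ≠ 0 := by
    simpa [Matrix.IsDiag, Pairwise] using hdiag
  have hii : H i i = H j j := by_contra fun h => hne (diagonal_lie_eq_zero_iff.1 hcomm i j h)
  obtain ⟨A, hA, hpos⟩ := exists_hessianForm_self_pos hH hij hne hii
  obtain ⟨c, hc, ⟨X, hX⟩, hX0, heig⟩ := exists_pos_eigenvector
    (g := (negTraceForm n ℝ).restrict W) (h := (hessianForm H).restrict W)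
    ⟨fun A B => (negTraceForm_isSymm n ℝ).eq A B⟩
    (fun A hA => negTraceForm_self_pos ((mem_W A).1 A.2) (by simpa using hA))
    ⟨fun A B => (hessianForm_isSymm hcomm).eq A B⟩ (v := ⟨A, (mem_W A).2 hA⟩) hpos
  exact ⟨c, hc, X, (mem_W X).1 hX, by simpa using hX0, fun B hB => heig ⟨B, (mem_W B).2 hB⟩⟩

section Isospectral

variable {A : Finset ℝ} {M : Mat A}

theorem separable_charpoly_of_mem_isospectral (hM : M ∈ isospectral A) : M.charpoly.Separable := by
  rw [hM.2]
  exact Polynomial.separable_prod_X_sub_C_iff'.2 fun x _ y _ hxy => hxy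

theorem trace_of_mem_isospectral (hM : M ∈ isospectral A) : M.trace = A.card * mean A := by
  have hsplits : M.charpoly.Splits :=
    hM.2 ▸ Polynomial.Splits.prod fun x _ => Polynomial.Splits.X_sub_C x
  rw [trace_eq_sum_roots_charpoly_of_splits hsplits, hM.2, Polynomial.roots_prod_X_sub_C, mean,
    mul_div_cancel_of_imp']
  · exact Finset.sum_val A
  · simp +contextual

theorem diagonal_mem_isospectral (A : Finset ℝ) :
    diagonal (fun i => (A.equivFin.symm i : ℝ)) ∈ isospectral A := by
  refine ⟨isSymm_diagonal _, ?_⟩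
  rw [charpoly_diagonal, ← Finset.prod_coe_sort A]
  exact A.equivFin.symm.prod_comp fun x : A => Polynomial.X - Polynomial.C (x : ℝ)

theorem orthogonal_conj_mem_isospectral {U : Mat A} (hU : U ∈ orthogonalGroup (Fin A.card) ℝ)
    (hM : M ∈ isospectral A) : U * M * Uᵀ ∈ isospectral A := by
  refine ⟨?_, (charpoly_orthogonal_conj hU M).trans hM.2⟩
  rw [IsSymm, transpose_mul, transpose_mul, transpose_transpose, hM.1.eq, Matrix.mul_assoc]

theorem exists_mem_isospectral_diag_eq_mean (A : Finset ℝ) :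
    ∃ M ∈ isospectral A, ∀ i, M i i = mean A := by
  have hD := diagonal_mem_isospectral A
  obtain ⟨U, hU, hmean⟩ := exists_orthogonal_conj_diag_eq_const (m := mean A)
    ((trace_of_mem_isospectral hD).trans (by rw [Fintype.card_fin]))
  exact ⟨_, orthogonal_conj_mem_isospectral hU hD, hmean⟩

end Isospectral

section Riemannian

variable {Λ : Finset ℝ} {H X Y A : Mat Λ}

theorem transpose_adInv (H X : Mat Λ) : (adInv H X)ᵀ = -adInv H X := by
  unfold adInv
  split_ifs with h
  · exact h.choose_spec.1
  · simp

theorem lie_adInv (hX : X ∈ tangentSpace H) : ⁅H, adInv H X⁆ = X := by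
  have h : ∃ Ω : Mat Λ, Ωᵀ = -Ω ∧ ⁅H, Ω⁆ = X := hX
  rw [adInv, dif_pos h]
  exact h.choose_spec.2

theorem adInv_of_notMem_tangentSpace (hX : X ∉ tangentSpace H) : adInv H X = 0 :=
  dif_neg hX

theorem lie_mem_tangentSpace (H : Mat Λ) (hA : Aᵀ = -A) : ⁅H, A⁆ ∈ tangentSpace H :=
  ⟨A, hA, rfl⟩

theorem adInv_lie (hH : H ∈ isospectral Λ) (hA : Aᵀ = -A) : adInv H ⁅H, A⁆ = A := by
  have hskew : (adInv H ⁅H, A⁆ - A)ᵀ = -(adInv H ⁅H, A⁆ - A) := by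
    rw [transpose_sub, transpose_adInv, hA]
    abel
  refine sub_eq_zero.1 (eq_zero_of_transpose_eq_neg_of_lie_eq_zero hH.1
    (separable_charpoly_of_mem_isospectral hH) hskew ?_)
  rw [lie_sub, lie_adInv (lie_mem_tangentSpace H hA), sub_self]

theorem normalMetric_eq_negTraceForm (H X Y : Mat Λ) :
    normalMetric H X Y = negTraceForm _ ℝ (adInv H X) (adInv H Y) :=
  (negTraceForm_apply _ _).symm

theorem hasLineDerivAt_dotProduct {V n : Type*} [AddCommGroup V] [Module ℝ V] [Fintype n]
    (f g : V →ₗ[ℝ] n → ℝ) (x v : V) :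
    HasLineDerivAt ℝ (fun y => f y ⬝ᵥ g y) (f v ⬝ᵥ g x + f x ⬝ᵥ g v) x v := by
  have hline : ∀ (φ : V →ₗ[ℝ] n → ℝ) (i : n),
      HasDerivAt (fun t : ℝ => φ (x + t • v) i) (φ v i) 0 := fun φ i => by
    simpa using ((hasDerivAt_id (0 : ℝ)).mul_const (φ v i)).const_add (φ x i)
  refine (HasDerivAt.fun_sum fun i (_ : i ∈ Finset.univ) =>
    (hline f i).fun_mul (hline g i)).congr_deriv ?_
  simp only [zero_smul, add_zero, Finset.sum_add_distrib, dotProduct]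

theorem lineDeriv_potential (K Z : Mat Λ) : lineDeriv ℝ potential K Z = K.diag ⬝ᵥ Z.diag := by
  let δ : Mat Λ →ₗ[ℝ] Fin Λ.card → ℝ := diagLinearMap _ ℝ ℝ
  have hδ : ∀ M, δ M = M.diag := fun _ => rfl
  have hpotential : potential = fun M : Mat Λ => ((1 / 2 : ℝ) • δ) M ⬝ᵥ δ M := by
    funext M
    rw [LinearMap.smul_apply, hδ, smul_dotProduct, smul_eq_mul]
    simp only [potential, dotProduct, diag_apply, sq]
  rw [hpotential, (hasLineDerivAt_dotProduct _ _ K Z).lineDeriv]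
  simp only [LinearMap.smul_apply, hδ, smul_dotProduct, smul_eq_mul]
  rw [dotProduct_comm Z.diag]
  ring

theorem hessian_eq_hessianForm (hX : X ∈ tangentSpace H) (Y : Mat Λ) :
    hessian H X Y = hessianForm H (adInv H X) (adInv H Y) := by
  simp only [hessian, lineDeriv_potential]
  rw [hessianForm_apply, lie_adInv hX]
  exact (hasLineDerivAt_dotProduct (diagLinearMap _ ℝ ℝ)
    (diagLinearMap _ ℝ ℝ ∘ₗ (LieAlgebra.ad ℝ (Mat Λ)).toLinearMap.flip (adInv H Y)) H X).lineDeriv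

theorem apply_eq_zero_of_mem_tangentVectors {E : Set (Mat Λ)} {i j : Fin Λ.card} {c : ℝ}
    (hE : ∀ K ∈ E, K i j = c) (hX : X ∈ tangentVectors E H) : X i j = 0 := by
  obtain ⟨γ, -, hγ, -, hderiv⟩ := hX
  rw [hderiv, funext fun t => hE _ (hγ t), deriv_const]

theorem coindexAt_eq_zero_iff {E : Set (Mat Λ)} :
    coindexAt E H = 0 ↔ ∀ c > 0, ∀ X ∈ eigenvectors E H c, X = 0 := by
  rw [coindexAt, Submodule.finrank_eq_zero, Submodule.span_eq_bot]
  simp only [Set.mem_iUnion, Set.mem_Ioi]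
  exact ⟨fun h c hc X hX => h X ⟨c, hc, hX⟩, fun h X ⟨c, hc, hX⟩ => h c hc X hX⟩

theorem coindexAt_eq_zero_of_isDiag (E : Set (Mat Λ)) (hH : H.IsDiag) : coindexAt E H = 0 := by
  refine coindexAt_eq_zero_iff.2 fun c hc X ⟨hXN, hX⟩ => ?_
  have hskew := transpose_adInv H X
  have hnonpos : c * negTraceForm _ ℝ (adInv H X) (adInv H X) ≤ 0 := by
    rw [← normalMetric_eq_negTraceForm, ← hX X hXN, hessian_eq_hessianForm hXN.1]
    exact hessianForm_self_nonpos_of_isDiag hH hskew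
  have hzero : adInv H X = 0 := by_contra fun hne =>
    hnonpos.not_gt (mul_pos hc (negTraceForm_self_pos hskew hne))
  rw [← lie_adInv hXN.1, hzero, lie_zero]

end Riemannian

namespace IsCriticalManifold

variable {Λ : Finset ℝ} {E : Set (Mat Λ)} {H K : Mat Λ}

theorem exists_eq_image_submatrix_blockDiagonal' (hE : IsCriticalManifold E) :
    ∃ (α : OrderedPartition Λ) (e : Fin Λ.card ≃ (p : Fin α.k) × Fin (α.part p).card),
      E = (fun B => (blockDiagonal' B).submatrix e e) ''
        {B | ∀ p, B p ∈ isospectral (α.part p) ∧ ∀ i, B p i i = mean (α.part p)} := by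
  obtain ⟨α, σ, rfl⟩ := hE
  have hconj : ∀ H : Mat Λ, (σ.permMatrix ℝ)ᵀ * H * σ.permMatrix ℝ = H.submatrix σ.symm σ.symm := by
    intro H
    rw [transpose_permMatrix, Equiv.Perm.permMatrix, Equiv.Perm.permMatrix,
      PEquiv.toMatrix_toPEquiv_mul, PEquiv.mul_toMatrix_toPEquiv, submatrix_submatrix]
    rfl
  refine ⟨α, σ.symm.trans α.index.symm, Set.ext fun H => ⟨?_, ?_⟩⟩
  · rintro ⟨_, ⟨B, hB, hmean, rfl⟩, rfl⟩
    exact ⟨B, fun p => ⟨hB p, hmean p⟩, (hconj (reindex α.index α.index (blockDiagonal' B))).symm⟩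
  · rintro ⟨B, hB, rfl⟩
    exact ⟨_, ⟨B, fun p => (hB p).1, fun p => (hB p).2, rfl⟩, hconj _⟩

protected theorem nonempty (hE : IsCriticalManifold E) : E.Nonempty := by
  obtain ⟨α, e, rfl⟩ := hE.exists_eq_image_submatrix_blockDiagonal'
  choose B hB using fun p => exists_mem_isospectral_diag_eq_mean (α.part p)
  exact ⟨_, B, hB, rfl⟩

theorem subset_isospectral (hE : IsCriticalManifold E) : E ⊆ isospectral Λ := by
  obtain ⟨α, e, rfl⟩ := hE.exists_eq_image_submatrix_blockDiagonal'
  rintro _ ⟨B, hB, rfl⟩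
  refine ⟨?_, ?_⟩
  · rw [IsSymm, transpose_submatrix, blockDiagonal'_transpose, funext fun p => (hB p).1.1.eq]
  · change (reindex e.symm e.symm (blockDiagonal' B)).charpoly = _
    rw [charpoly_reindex, charpoly_blockDiagonal', Finset.prod_congr rfl fun p _ => (hB p).1.2,
      ← Finset.prod_biUnion fun p _ q _ => α.disjoint p q, α.union]

theorem exists_block_structure (hE : IsCriticalManifold E) :
    ∃ (α : OrderedPartition Λ) (block : Fin Λ.card → Fin α.k), ∀ H ∈ E,
      (∀ i, H i i = mean (α.part (block i))) ∧ ∀ i j, block i ≠ block j → H i j = 0 := by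
  obtain ⟨α, e, rfl⟩ := hE.exists_eq_image_submatrix_blockDiagonal'
  refine ⟨α, fun i => (e i).1, ?_⟩
  rintro _ ⟨B, hB, rfl⟩
  exact ⟨fun i => (blockDiagonal'_apply_eq B _ _ _).trans ((hB _).2 _),
    fun i j => blockDiagonal'_apply_ne B _ _⟩

theorem diag_eq (hE : IsCriticalManifold E) (hH : H ∈ E) (hK : K ∈ E) : H.diag = K.diag := by
  obtain ⟨α, block, hblock⟩ := hE.exists_block_structure
  exact funext fun i => ((hblock H hH).1 i).trans ((hblock K hK).1 i).symm

theorem diagonal_diag_lie (hE : IsCriticalManifold E) (hH : H ∈ E) (hK : K ∈ E) :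
    ⁅diagonal H.diag, K⁆ = 0 := by
  obtain ⟨α, block, hblock⟩ := hE.exists_block_structure
  refine diagonal_lie_eq_zero_iff.2 fun i j hij => (hblock K hK).2 i j fun hsame => hij ?_
  rw [diag_apply, diag_apply, (hblock H hH).1, (hblock H hH).1, hsame]

theorem eq_singleton_of_isDiag (hE : IsCriticalManifold E) (hH : H ∈ E) (hdiag : H.IsDiag) :
    E = {H} := by
  have hinj : Function.Injective H.diag := by
    have hsep := separable_charpoly_of_mem_isospectral (hE.subset_isospectral hH)
    rwa [← hdiag.diagonal_diag, charpoly_diagonal, Polynomial.separable_prod_X_sub_C_iff] at hsep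
  refine Set.eq_singleton_iff_unique_mem.2 ⟨hH, fun K hK => ?_⟩
  have hKdiag : K.IsDiag := fun i j hij =>
    diagonal_lie_eq_zero_iff.1 (hE.diagonal_diag_lie hH hK) i j (hinj.ne hij)
  rw [← hKdiag.diagonal_diag, hE.diag_eq hK hH, hdiag.diagonal_diag]

theorem hessianForm_adInv_eq_zero (hE : IsCriticalManifold E) (hH : H ∈ E) {Y : Mat Λ}
    (hY : Y ∈ tangentVectors E H) (A : Mat Λ) : hessianForm H (adInv H Y) A = 0 := by
  by_cases hYt : Y ∈ tangentSpace H
  · refine hessianForm_eq_zero_of_diag_eq_zero ?_ ?_ A <;> rw [lie_adInv hYt]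
    · ext i
      exact apply_eq_zero_of_mem_tangentVectors (fun K hK => congrFun (hE.diag_eq hK hH) i) hY
    · refine diagonal_lie_eq_zero_iff.2 fun i j hij =>
        apply_eq_zero_of_mem_tangentVectors (c := 0) (fun K hK => ?_) hY
      exact diagonal_lie_eq_zero_iff.1 (hE.diagonal_diag_lie hH hK) i j hij
  · rw [adInv_of_notMem_tangentSpace hYt, map_zero, LinearMap.zero_apply]

theorem lie_mem_eigenvectors (hE : IsCriticalManifold E) (hH : H ∈ E) {A : Mat Λ} {c : ℝ}
    (hc : c ≠ 0) (hA : Aᵀ = -A)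
    (heig : ∀ B, Bᵀ = -B → hessianForm H A B = c * negTraceForm _ ℝ A B) :
    ⁅H, A⁆ ∈ eigenvectors E H c := by
  have hAt := lie_mem_tangentSpace H hA
  have hAinv := adInv_lie (hE.subset_isospectral hH) hA
  refine ⟨⟨hAt, fun Y hY => ?_⟩, fun Y _ => ?_⟩
  · have hzero : hessianForm H A (adInv H Y) = 0 :=
      ((hessianForm_isSymm (hE.diagonal_diag_lie hH hH)).eq (adInv H Y) A).symm.trans
        (hE.hessianForm_adInv_eq_zero hH hY A)
    rw [heig _ (transpose_adInv H Y)] at hzero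
    rw [normalMetric_eq_negTraceForm, hAinv]
    exact (mul_eq_zero.1 hzero).resolve_left hc
  · rw [hessian_eq_hessianForm hAt, normalMetric_eq_negTraceForm, hAinv,
      heig _ (transpose_adInv H Y)]

theorem isDiag_of_coindexAt_eq_zero (hE : IsCriticalManifold E) (hH : H ∈ E)
    (hindex : coindexAt E H = 0) : H.IsDiag := by
  by_contra hdiag
  have hiso := hE.subset_isospectral hH
  obtain ⟨c, hc, A, hA, hA0, heig⟩ :=
    exists_skew_eigenvector_hessianForm hiso.1 (hE.diagonal_diag_lie hH hH) hdiag
  have hzero : ⁅H, A⁆ = 0 :=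
    coindexAt_eq_zero_iff.1 hindex c hc _ (hE.lie_mem_eigenvectors hH hc.ne' hA heig)
  exact hA0 (eq_zero_of_transpose_eq_neg_of_lie_eq_zero hiso.1
    (separable_charpoly_of_mem_isospectral hiso) hA hzero)

end IsCriticalManifold

end DiagonalPotential

end

theorem mainTheorem5_general (Λ : Finset ℝ) (E : Set (DiagonalPotential.Mat Λ))
    (hE : DiagonalPotential.IsCriticalManifold E) :
    ((∃ H ∈ E, DiagonalPotential.coindexAt E H = 0) ↔
      ∃ D : DiagonalPotential.Mat Λ, D.IsDiag ∧ E = {D}) ∧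
    ((∀ H ∈ E, DiagonalPotential.coindexAt E H = 0) ↔
      ∃ D : DiagonalPotential.Mat Λ, D.IsDiag ∧ E = {D}) := by
  have diag_of_stable : (∃ H ∈ E, DiagonalPotential.coindexAt E H = 0) →
      ∃ D : DiagonalPotential.Mat Λ, D.IsDiag ∧ E = {D} := by
    rintro ⟨H, hH, hindex⟩
    have hdiag := hE.isDiag_of_coindexAt_eq_zero hH hindex
    exact ⟨H, hdiag, hE.eq_singleton_of_isDiag hH hdiag⟩
  have stable_of_diag : (∃ D : DiagonalPotential.Mat Λ, D.IsDiag ∧ E = {D}) →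
      ∀ H ∈ E, DiagonalPotential.coindexAt E H = 0 := by
    rintro ⟨D, hD, rfl⟩ H rfl
    exact DiagonalPotential.coindexAt_eq_zero_of_isDiag _ hD
  obtain ⟨H, hH⟩ := hE.nonempty
  exact ⟨⟨diag_of_stable, fun h => ⟨H, hH, stable_of_diag h H hH⟩⟩,
    ⟨fun h => diag_of_stable ⟨H, hH, h H hH⟩, stable_of_diag⟩⟩

theorem mainTheorem5 (Λ : Finset ℝ) (hΛ : DiagonalPotential.StronglyDisjoint Λ)
    (E : Set (DiagonalPotential.Mat Λ)) (hE : DiagonalPotential.IsCriticalManifold E) :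
    ((∃ H ∈ E, DiagonalPotential.coindexAt E H = 0) ↔
      ∃ D : DiagonalPotential.Mat Λ, D.IsDiag ∧ E = {D}) ∧
    ((∀ H ∈ E, DiagonalPotential.coindexAt E H = 0) ↔
      ∃ D : DiagonalPotential.Mat Λ, D.IsDiag ∧ E = {D}) :=
  mainTheorem5_general Λ E hE
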